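/- Let $\Omega\subset\mathbb{R}^2$ be an open set, let $\mathcal{H}^1$ be the one-dimensional Hausdorff measure on $\mathbb{R}^2$, and let $\mathcal{K}(\Omega)$ be the class of compact connected sets $K\subset\overline{\Omega}$ with $\mathcal{H}^1(K)<+\infty$. For $K\in\mathcal{K}(\Omega)$ write $L^p(K)=L^p(K,d\mathcal{H}^1)$, with norm $\|\cdot\|_p$, and let $\tau_K(x)$ be a unit vector in the direction of the approximate tangent line of $K$ at $x$, which exists at $\mathcal{H}^1$-a.e. $x\in K$ (set $\tau_K(x)=0$ where there is none). Here a line $x+\ell$ is an approximate tangent line of $K$ at $x$ if $\limsup_{r\to0^+}\mathcal{H}^1(K\cap \overline{B}(x,r))/(2r)>0$ and, for all $s\in(0,1)$, $r^{-1}\,\mathcal{H}^1\big(\{y\in K\cap \overline{B}(x,r):\operatorname{dist}(y-x,\ell)\ge s|y-x|\}\big)\to0$ as $r\to0^+$. The space $H^1(K)$ is the set of all $u\in L^2(K)$ for which there are $\varphi_n\in C^\infty(\mathbb{R}^2)$ such that $\varphi_n|_K\to u$ in $L^2(K)$ and $(\nabla\varphi_n\cdot\tau_K)\tau_K$ converges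 in $L^2(K;\mathbb{R}^2)$; the limit is denoted by $\nabla_K u$. (Equivalently, $H^1(K)$ is the completion of the restrictions to $K$ of functions in $C^\infty(\mathbb{R}^2)$ for the norm $(\|\varphi\|_2^2+\|\nabla\varphi\cdot\tau_K\|_2^2)^{1/2}$.) Let $K\in\mathcal{K}(\Omega)$. Then every $u\in H^1(K)$ is (essentially) bounded, that is, $u\in L^\infty(K)$. Moreover, for every such $u$ and every limit $\nabla_K u$ obtained as above, $$\|u\|_{L^\infty(K)}\le \frac{1}{\mathcal{H}^1(K)^{1/2}}\,\|u\|_2+\mathcal{H}^1(K)^{1/2}\,\|\nabla_K u\|_2 .$$ (If $\mathcal{H}^1(K)=0$, all the norms vanish, and the first term on the right is read as $0$.) -/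

import Mathlib

open MeasureTheory Filter Topology
open scoped ENNReal Gradient

/-- The Euclidean plane `ℝ²`. -/
abbrev Plane : Type := EuclideanSpace ℝ (Fin 2)

/-- The class `𝒦(Ω)` of compact connected subsets of the closure of `Ω` with finite length. -/
def roadClass (Ω : Set Plane) : Set (Set Plane) :=
  {K | K ⊆ closure Ω ∧ IsCompact K ∧ IsConnected K ∧ μH[1] K < ∞}

/-- The one-dimensional Hausdorff measure restricted to `K`; `L^p(K)` refers to this measure. -/
noncomputable def lengthOn (K : Set Plane) : Measure Plane := (μH[1] : Measure Plane).restrict K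

/-- The open double cone `{y : dist (y - x, ℓ) < s |y - x|}` with vertex `x` around the line
`x + ℓ`. -/
def coneAround (x : Plane) (ℓ : Submodule ℝ Plane) (s : ℝ) : Set Plane :=
  {y | Metric.infDist (y - x) (ℓ : Set Plane) < s * ‖y - x‖}

/-- `x + ℓ` is an approximate tangent line of `K` at `x`: the upper one-dimensional density of `K`
at `x` is positive, and outside every cone around `x + ℓ` the set `K` has density zero at `x`. -/
def IsApproxTangentLine (K : Set Plane) (x : Plane) (ℓ : Submodule ℝ Plane) : Prop :=
  Module.finrank ℝ ℓ = 1 ∧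
  0 < limsup (fun r : ℝ => μH[1] (K ∩ Metric.closedBall x r) / ENNReal.ofReal (2 * r)) (𝓝[>] 0) ∧
  ∀ s : ℝ, 0 < s → s < 1 →
    Tendsto (fun r : ℝ =>
      μH[1] ((K ∩ Metric.closedBall x r) \ coneAround x ℓ s) / ENNReal.ofReal r) (𝓝[>] 0) (𝓝 0)

open Classical in
/-- The unit tangent `τ_K(x)`: a choice of a unit vector in the direction of an approximate tangent
line of `K` at `x`, at the points where there is one (and `0` at the other points). Only
`(w · τ_K) τ_K` is used below, which does not depend on the choice of orientation. -/
noncomputable def unitTangent (K : Set Plane) (x : Plane) : Plane :=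
  if h : ∃ τ : Plane, ‖τ‖ = 1 ∧ IsApproxTangentLine K x (Submodule.span ℝ {τ}) then h.choose else 0

/-- For smooth `φ` on the plane, the projection `(∇φ · τ_K) τ_K` of the gradient on `K`. -/
noncomputable def smoothTangentialGradient (K : Set Plane) (φ : Plane → ℝ) (x : Plane) : Plane :=
  (inner ℝ (∇ φ x) (unitTangent K x)) • unitTangent K x

/-- `g = ∇_K u`: the vector field `g ∈ L²(K; ℝ²)` is the `L²(K)` limit of `(∇φₙ · τ_K) τ_K` for some
smooth functions `φₙ` on the plane whose restrictions to `K` converge to `u` in `L²(K)`. -/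
def IsTangentialGradient (K : Set Plane) (u : Plane → ℝ) (g : Plane → Plane) : Prop :=
  MemLp g 2 (lengthOn K) ∧
  ∃ φ : ℕ → Plane → ℝ, (∀ n, ContDiff ℝ (⊤ : ℕ∞) (φ n)) ∧
    Tendsto (fun n => eLpNorm (fun x => φ n x - u x) 2 (lengthOn K)) atTop (𝓝 0) ∧
    Tendsto (fun n => eLpNorm (fun x => smoothTangentialGradient K (φ n) x - g x) 2 (lengthOn K))
      atTop (𝓝 0)

/-- The Sobolev space `H¹(K)`: the functions `u ∈ L²(K)` that are limits of (restrictions to `K` of)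
smooth functions on the plane in the norm `(‖φ‖₂² + ‖∇φ · τ_K‖₂²)^{1/2}`. -/
def sobolevH1 (K : Set Plane) : Set (Plane → ℝ) :=
  {u | MemLp u 2 (lengthOn K) ∧ ∃ g, IsTangentialGradient K u g}

/-! ### Lipschitz arcs in connected sets of finite length -/

section Curves

variable {X : Type*} [MetricSpace X]

open scoped NNReal

/-! For smooth `φ` the oscillation on `K` is at most `μH[1] K ^ (1/2)` times the `L²` norm of the
tangential gradient. Averaging over a second point of `K` gives the estimate for `φ`, and lower
semicontinuity of the `L^∞` norm carries it to `u`.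

The oscillation bound integrates `∇φ · γ'` along an injective Lipschitz arc `γ` in `K` joining the
two points (`IsCompact.exists_lipschitz_arc`). Two facts turn this into an integral on `K`. First,
`‖γ'‖ dt` pushed forward by `γ` is at most `μH[1]` on `K` (`map_speedMeasure_le`). Only this
inequality is needed, and it rests on a connected set being at least as long as the distance between
any two of its points. Secondly, for almost every `t` with `γ'(t) ≠ 0`, the vector `γ'(t)` spans the
approximate tangent line of the whole of `K` (`ae_isApproxTangentLine_of_arc`): the rest of `K` has
density zero there, since its length is singular to the image of `dt`. Cauchy–Schwarz then
concludes. -/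

theorem IsPreconnected.exists_chain_of_cover {K : Set X} (hK : IsPreconnected K) {ε : ℝ}
    {C : Finset X} (hC : (C : Set X) ⊆ K) (hcov : ∀ p ∈ K, ∃ c ∈ C, dist p c ≤ ε)
    {a b : X} (ha : a ∈ C) (hb : b ∈ C) :
    ∃ (v : ℕ → X) (m : ℕ), m ≤ C.card ∧ v 0 = a ∧ v m = b ∧ (∀ i, v i ∈ C) ∧
      ∀ i, dist (v i) (v (i + 1)) ≤ 2 * ε := by
  classical
  have hε : 0 ≤ ε := by
    obtain ⟨c, -, hc⟩ := hcov a (hC ha)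
    exact dist_nonneg.trans hc
  let G : SimpleGraph C := SimpleGraph.fromRel fun p q => dist (p : X) q ≤ 2 * ε
  have hadj : ∀ p q : C, p ≠ q → dist (p : X) q ≤ 2 * ε → G.Adj p q := fun p q h h' =>
    (SimpleGraph.fromRel_adj _ _ _).2 ⟨h, Or.inl h'⟩
  have hreach : G.Reachable ⟨a, ha⟩ ⟨b, hb⟩ := by
    by_contra hnot
    -- Balls around reachable and unreachable points form two closed sets covering the connected
    -- `K`, so they meet; a common point produces an edge between the two classes.
    let U : Set X := ⋃ p ∈ {p : C | G.Reachable ⟨a, ha⟩ p}, Metric.closedBall (p : X) ε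
    let V : Set X := ⋃ p ∈ {p : C | ¬ G.Reachable ⟨a, ha⟩ p}, Metric.closedBall (p : X) ε
    have hU : IsClosed U := (Set.toFinite _).isClosed_biUnion fun p _ => Metric.isClosed_closedBall
    have hV : IsClosed V := (Set.toFinite _).isClosed_biUnion fun p _ => Metric.isClosed_closedBall
    obtain ⟨z, -, hzU, hzV⟩ := isPreconnected_closed_iff.1 hK U V hU hV
      (fun p hp => by
        obtain ⟨c, hc, hpc⟩ := hcov p hp
        by_cases h : G.Reachable ⟨a, ha⟩ ⟨c, hc⟩
        · exact Or.inl (Set.mem_biUnion (show (⟨c, hc⟩ : C) ∈ {p : C | _} from h) hpc)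
        · exact Or.inr (Set.mem_biUnion (show (⟨c, hc⟩ : C) ∈ {p : C | _} from h) hpc))
      ⟨a, hC ha, Set.mem_biUnion (show (⟨a, ha⟩ : C) ∈ {p : C | G.Reachable ⟨a, ha⟩ p} from
        SimpleGraph.Reachable.refl _) (Metric.mem_closedBall_self hε)⟩
      ⟨b, hC hb, Set.mem_biUnion (show (⟨b, hb⟩ : C) ∈ {p : C | ¬ G.Reachable ⟨a, ha⟩ p} from
        hnot) (Metric.mem_closedBall_self hε)⟩
    simp only [U, V, Set.mem_iUnion, Set.mem_ofPred_eq, exists_prop] at hzU hzV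
    obtain ⟨p, hp, hzp⟩ := hzU
    obtain ⟨q, hq, hzq⟩ := hzV
    have hpq : p ≠ q := by rintro rfl; exact hq hp
    have hd : dist (p : X) q ≤ 2 * ε := by
      have h1 := dist_triangle_left (p : X) q z
      rw [Metric.mem_closedBall] at hzp hzq
      linarith
    exact hq (hp.trans (hadj p q hpq hd).reachable)
  obtain ⟨w, hw⟩ := hreach.exists_isPath
  refine ⟨fun i => w.getVert i, w.length, ?_, by simp, by simp, fun i => (w.getVert i).2, ?_⟩
  · simpa using hw.length_lt.le
  · intro i
    rcases lt_or_ge i w.length with hi | hi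
    · have := w.adj_getVert_succ hi
      rw [SimpleGraph.fromRel_adj] at this
      rcases this.2 with h | h
      · exact h
      · rw [dist_comm]; exact h
    -- Past its length the walk stays at its last vertex, so later steps have length zero.
    · dsimp only
      rw [w.getVert_of_length_le hi, w.getVert_of_length_le (by omega)]
      simpa using hε

theorem dist_le_mul_of_chain {v : ℕ → X} {δ : ℝ}
    (hv : ∀ i, dist (v i) (v (i + 1)) ≤ δ) {i j : ℕ} (hij : i ≤ j) :
    dist (v i) (v j) ≤ (j - i : ℝ) * δ := by
  have := dist_le_Ico_sum_of_dist_le (f := v) hij (d := fun _ => δ) (fun _ _ => hv _)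
  simpa [Nat.cast_sub hij] using this

/-- A compactness principle for curves which are Lipschitz up to a vanishing error. -/
theorem IsCompact.exists_lipschitz_limit_curve {K : Set X} (hc : IsCompact K) {x y : X}
    {γ : ℕ → ℝ → X} (hγ : ∀ n t, γ n t ∈ K) {A e : ℕ → ℝ} {L : ℝ≥0}
    (hA : Tendsto A atTop (𝓝 L)) (he : Tendsto e atTop (𝓝 0))
    (hlip : ∀ n s t, dist (γ n s) (γ n t) ≤ A n * |s - t| + e n)
    (hx : ∀ n, dist (γ n 0) x ≤ e n) (hy : ∀ n, dist (γ n 1) y ≤ e n) :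
    ∃ η : ℝ → X, (∀ t, η t ∈ K) ∧ LipschitzWith L η ∧ η 0 = x ∧ η 1 = y := by
  -- Along an ultrafilter all pointwise limits in the compact `K` exist at once, without extracting
  -- subsequences.
  let F : Ultrafilter ℕ := hyperfilter ℕ
  have hF : (F : Filter ℕ) ≤ atTop := Nat.hyperfilter_le_atTop
  have hlim : ∀ t, ∃ z ∈ K, Tendsto (fun n => γ n t) F (𝓝 z) := by
    intro t
    obtain ⟨z, hz, h⟩ := hc.ultrafilter_le_nhds (F.map fun n => γ n t)
      (by rw [le_principal_iff]; exact Filter.mem_map.2 (Filter.univ_mem' fun n => hγ n t))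
    exact ⟨z, hz, h⟩
  choose η hηK hη using hlim
  refine ⟨η, hηK, LipschitzWith.of_dist_le_mul fun s t => ?_, ?_, ?_⟩
  · have h2 : Tendsto (fun n => A n * |s - t| + e n) F (𝓝 (L * |s - t| + 0)) :=
      ((hA.mul_const _).add he).mono_left hF
    rw [add_zero] at h2
    exact le_of_tendsto_of_tendsto' ((hη s).dist (hη t)) h2 fun n => hlip n s t
  · refine dist_le_zero.1 (le_of_tendsto_of_tendsto' ((hη 0).dist tendsto_const_nhds)
      (he.mono_left hF) hx)
  · refine dist_le_zero.1 (le_of_tendsto_of_tendsto' ((hη 1).dist tendsto_const_nhds)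
      (he.mono_left hF) hy)

/-- Delete the loop over `[s, t]` and stretch the remaining time, of length `1 - (t - s)`, back to
`[0, 1]`. Distinct endpoints exclude a loop over the whole interval. -/
theorem LipschitzWith.exists_shortcut {L : ℝ≥0} {γ : ℝ → X} (hγ : LipschitzWith L γ) {s t : ℝ}
    (hs : 0 ≤ s) (hst : s ≤ t) (ht : t ≤ 1) (h : γ s = γ t) (hne : γ 0 ≠ γ 1) :
    ∃ η : ℝ → X, Set.range η ⊆ Set.range γ ∧ η 0 = γ 0 ∧ η 1 = γ 1 ∧
      LipschitzWith (L * Real.toNNReal (1 - (t - s))) η := by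
  have hd : 0 ≤ 1 - (t - s) := by linarith
  let η : ℝ → X := fun q => if q ≤ s then γ q else γ (q + (t - s))
  have hη : LipschitzWith L η := by
    have key : ∀ p q, p ≤ q → dist (η p) (η q) ≤ L * dist p q := by
      intro p q hpq
      simp only [η]
      split_ifs with h1 h2 h2
      · exact hγ.dist_le_mul _ _
      · have e1 := hγ.dist_le_mul p s
        have e2 := hγ.dist_le_mul t (q + (t - s))
        have e3 := dist_triangle (γ p) (γ s) (γ (q + (t - s)))
        rw [Real.dist_eq, abs_sub_comm, abs_of_nonneg (by linarith)] at e1 e2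
        rw [Real.dist_eq, abs_sub_comm, abs_of_nonneg (by linarith)]
        rw [← h] at e2
        linarith
      · exact absurd (hpq.trans h2) h1
      · simpa using hγ.dist_le_mul (p + (t - s)) (q + (t - s))
    refine LipschitzWith.of_dist_le_mul fun p q => ?_
    rcases le_total p q with h | h
    · exact key p q h
    · rw [dist_comm, dist_comm p q]; exact key q p h
  refine ⟨fun r => η ((1 - (t - s)) * r), ?_, ?_, ?_, ?_⟩
  · rintro _ ⟨r, rfl⟩
    simp only [η]
    split_ifs <;> exact Set.mem_range_self _
  · simp [η, hs]
  · simp only [η, mul_one]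
    split_ifs with h1
    · have ht1 : t = 1 := by linarith
      rcases eq_or_ne s 0 with h0 | h0
      · subst h0; subst ht1; exact absurd h hne
      · have : 1 - (t - s) = s := by linarith
        rw [this, h, ht1]
    · congr 1; ring
  · refine hη.comp (LipschitzWith.of_dist_le_mul fun p q => ?_)
    rw [Real.coe_toNNReal _ hd, Real.dist_eq, ← mul_sub, abs_mul, abs_of_nonneg hd, Real.dist_eq]

variable [MeasurableSpace X] [BorelSpace X]

/-- The 1-Lipschitz function `dist · x` maps `K` onto a connected set containing `[0, ρ]`, and the
values up to `ρ` are taken inside the ball. -/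
theorem IsPreconnected.ofReal_le_hausdorffMeasure_inter_closedBall {K : Set X}
    (hK : IsPreconnected K) {x z : X} (hx : x ∈ K) (hz : z ∈ K) {ρ : ℝ} (hρ : ρ ≤ dist x z) :
    ENNReal.ofReal ρ ≤ μH[1] (K ∩ Metric.closedBall x ρ) := by
  have hlip : LipschitzWith 1 (fun y : X => dist y x) := LipschitzWith.dist_left x
  have hsub : Set.Icc 0 ρ ⊆ (fun y : X => dist y x) '' (K ∩ Metric.closedBall x ρ) := by
    intro s hs
    have h1 := (hK.image _ hlip.continuous.continuousOn).Icc_subset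
      (Set.mem_image_of_mem _ hx) (Set.mem_image_of_mem _ hz)
    obtain ⟨y, hy, rfl⟩ := h1 (show s ∈ Set.Icc (dist x x) (dist z x) from
      ⟨by simpa using hs.1, by rw [dist_comm z x]; exact hs.2.trans hρ⟩)
    exact ⟨y, ⟨hy, hs.2⟩, rfl⟩
  calc ENNReal.ofReal ρ = volume (Set.Icc 0 ρ) := by simp
    _ = μH[1] (Set.Icc 0 ρ) := by rw [hausdorffMeasure_real]
    _ ≤ μH[1] ((fun y : X => dist y x) '' (K ∩ Metric.closedBall x ρ)) := measure_mono hsub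
    _ ≤ _ := by simpa using hlip.hausdorffMeasure_image_le zero_le_one _

theorem IsPreconnected.edist_le_hausdorffMeasure {K : Set X}
    (hK : IsPreconnected K) {x z : X} (hx : x ∈ K) (hz : z ∈ K) :
    edist x z ≤ μH[1] K := by
  rw [edist_dist]
  exact (hK.ofReal_le_hausdorffMeasure_inter_closedBall hx hz le_rfl).trans
    (measure_mono Set.inter_subset_left)

/-- The balls of radius `ε / 3` around the separated points are disjoint, and each contains length
at least `ε / 3` of `K`. -/
theorem IsPreconnected.encard_mul_le_hausdorffMeasure {K : Set X} (hK : IsPreconnected K)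
    {ε : ℝ≥0} (hε : 0 < ε) (hfar : ∀ p ∈ K, ∃ z ∈ K, (ε : ℝ) ≤ dist p z) {C : Finset X}
    (hC : (C : Set X) ⊆ K) (hsep : Metric.IsSeparated ε (C : Set X)) :
    (C.card : ℝ≥0∞) * ENNReal.ofReal (ε / 3) ≤ μH[1] K := by
  have hε' : (0 : ℝ) < ε := hε
  have hdisj : (C : Set X).PairwiseDisjoint (fun p => Metric.closedBall p ((ε : ℝ) / 3)) := by
    intro p hp q hq hpq
    refine Metric.closedBall_disjoint_closedBall ?_
    have h : (ε : ℝ≥0∞) < edist p q := hsep hp hq hpq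
    rw [edist_nndist, ENNReal.coe_lt_coe] at h
    have : (ε : ℝ) < dist p q := h
    linarith
  calc (C.card : ℝ≥0∞) * ENNReal.ofReal (ε / 3) = ∑ p ∈ C, ENNReal.ofReal (ε / 3) := by simp
    _ ≤ ∑ p ∈ C, (μH[1]).restrict K (Metric.closedBall p ((ε : ℝ) / 3)) := by
        refine Finset.sum_le_sum fun p hp => ?_
        obtain ⟨z, hz, hpz⟩ := hfar p (hC hp)
        rw [Measure.restrict_apply Metric.isClosed_closedBall.measurableSet, Set.inter_comm]
        exact hK.ofReal_le_hausdorffMeasure_inter_closedBall (hC hp) hz (by linarith)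
    _ = (μH[1]).restrict K (⋃ p ∈ C, Metric.closedBall p ((ε : ℝ) / 3)) :=
        (measure_biUnion_finset hdisj fun p _ => Metric.isClosed_closedBall.measurableSet).symm
    _ ≤ _ := (measure_mono (Set.subset_univ _)).trans (by simp)

/-- A step function running at constant rate through a chain in a maximal `ε`-separated subset of
`K`; the length of `K` bounds the number of points. -/
theorem IsPreconnected.exists_almost_lipschitz_curve {K : Set X} (hK : IsPreconnected K)
    (hfin : μH[1] K < ∞) {x y : X} (hx : x ∈ K) (hy : y ∈ K)
    {ε : ℝ} (hε : 0 < ε) (hxy : 2 * ε ≤ dist x y) :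
    ∃ γ : ℝ → X, (∀ t, γ t ∈ K) ∧ dist (γ 0) x ≤ 2 * ε ∧ dist (γ 1) y ≤ 2 * ε ∧
      ∀ s t, dist (γ s) (γ t) ≤ 6 * (μH[1] K).toReal * |s - t| + 2 * ε := by
  lift ε to ℝ≥0 using hε.le
  have hε' : 0 < ε := hε
  have hfar : ∀ p ∈ K, ∃ z ∈ K, (ε : ℝ) ≤ dist p z := by
    intro p _
    by_contra! h
    have h1 := h x hx
    have h2 := h y hy
    have := dist_triangle_left x y p
    linarith
  have hcardR : ∀ C : Finset X, (C : Set X) ⊆ K → Metric.IsSeparated ε (C : Set X) →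
      C.card * (ε / 3 : ℝ) ≤ (μH[1] K).toReal := by
    intro C h1 h2
    have h3 := hK.encard_mul_le_hausdorffMeasure hε' hfar h1 h2
    have h4 := ENNReal.toReal_mono hfin.ne h3
    rwa [ENNReal.toReal_mul, ENNReal.toReal_ofReal (by positivity), ENNReal.toReal_natCast] at h4
  have hpack : Metric.packingNumber ε K ≠ ⊤ := by
    obtain ⟨N, hN⟩ := exists_nat_ge ((μH[1] K).toReal / (ε / 3 : ℝ))
    have hle : Metric.packingNumber ε K ≤ N := by
      refine iSup_le fun C => iSup_le fun hCK => iSup_le fun hsep => ?_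
      by_contra! hlt
      obtain ⟨D, hDC, hD⟩ := Set.exists_subset_encard_eq (Order.add_one_le_of_lt hlt)
      have hDfin : D.Finite := Set.finite_of_encard_eq_coe (k := N + 1) (by exact_mod_cast hD)
      lift D to Finset X using hDfin
      rw [Set.encard_coe_eq_coe_finsetCard] at hD
      have hD' : D.card = N + 1 := by exact_mod_cast hD
      have := hcardR D (hDC.trans hCK) (hsep.mono hDC)
      rw [← le_div_iff₀ (by positivity), hD'] at this
      push_cast at this
      linarith
    exact ne_top_of_le_ne_top (ENat.natCast_ne_top N) hle
  obtain ⟨C, hCcoe⟩ : ∃ C : Finset X, (C : Set X) = Metric.maximalSeparatedSet ε K := by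
    exact (Set.encard_ne_top_iff.1
      (by rwa [Metric.encard_maximalSeparatedSet hpack])).exists_finset_coe
  have hCK : (C : Set X) ⊆ K := hCcoe ▸ Metric.maximalSeparatedSet_subset
  have hcov : ∀ p ∈ K, ∃ c ∈ C, dist p c ≤ ε := by
    intro p hp
    obtain ⟨c, hc, hpc⟩ := Metric.isCover_maximalSeparatedSet hpack hp
    rw [← hCcoe] at hc
    refine ⟨c, hc, ?_⟩
    have : edist p c ≤ ε := hpc
    rwa [edist_nndist, ENNReal.coe_le_coe] at this
  obtain ⟨a, ha, hxa⟩ := hcov x hx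
  obtain ⟨b, hb, hyb⟩ := hcov y hy
  obtain ⟨v, m, hm, hv0, hvm, hvC, hstep⟩ := hK.exists_chain_of_cover hCK hcov ha hb
  -- At most `3 μH[1] K / ε` steps, each of length at most `2 ε`.
  have hmH : m * (2 * ε : ℝ) ≤ 6 * (μH[1] K).toReal := by
    have h1 := hcardR C hCK (hCcoe ▸ Metric.isSeparated_maximalSeparatedSet)
    have h2 : (m : ℝ) * (ε / 3) ≤ C.card * (ε / 3) := by gcongr
    linarith
  have key : ∀ s t : ℝ, s ≤ t → dist (v ⌊s * m⌋₊) (v ⌊t * m⌋₊) ≤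
      6 * (μH[1] K).toReal * |s - t| + 2 * ε := by
    intro s t hst
    have hle : s * m ≤ t * m := by gcongr
    have h1 := dist_le_mul_of_chain hstep (Nat.floor_mono hle)
    -- Rounding costs at most one step, the source of the additive error `2 * ε`. At negative times
    -- the floor is `0`.
    have h2 : ((⌊t * m⌋₊ : ℝ) - ⌊s * m⌋₊) ≤ (t - s) * m + 1 := by
      rcases le_or_gt 0 (t * m) with h | h
      · have := Nat.floor_le h
        have := Nat.lt_floor_add_one (s * m)
        linarith
      · rw [Nat.floor_of_nonpos h.le, Nat.floor_of_nonpos (hle.trans h.le)]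
        have : 0 ≤ (t - s) * m := by nlinarith
        simp only [Nat.cast_zero]
        linarith
    rw [abs_sub_comm, abs_of_nonneg (sub_nonneg.2 hst)]
    calc _ ≤ _ := h1
      _ ≤ ((t - s) * m + 1) * (2 * ε) := by gcongr
      _ = (t - s) * (m * (2 * ε)) + 2 * ε := by ring
      _ ≤ (t - s) * (6 * (μH[1] K).toReal) + 2 * ε := by
        have := sub_nonneg.2 hst
        gcongr
      _ = _ := by ring
  refine ⟨fun t => v ⌊t * m⌋₊, fun t => hCK (hvC _), ?_, ?_, fun s t => ?_⟩
  · simp only [zero_mul, Nat.floor_zero, hv0]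
    rw [dist_comm]; linarith
  · simp only [one_mul, Nat.floor_natCast, hvm]
    rw [dist_comm]; linarith
  · rcases le_total s t with h | h
    · exact key s t h
    · rw [dist_comm, abs_sub_comm]; exact key t s h

theorem IsCompact.exists_lipschitz_curve {K : Set X} (hc : IsCompact K)
    (hK : IsPreconnected K) (hfin : μH[1] K < ∞) {x y : X} (hx : x ∈ K) (hy : y ∈ K)
    (hxy : x ≠ y) :
    ∃ (L : ℝ≥0) (η : ℝ → X), (∀ t, η t ∈ K) ∧ LipschitzWith L η ∧ η 0 = x ∧ η 1 = y := by
  have hd : 0 < dist x y := dist_pos.2 hxy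
  let e : ℕ → ℝ := fun n => dist x y / 2 * (1 / ((n : ℝ) + 1))
  have he : Tendsto e atTop (𝓝 0) := by
    simpa [e] using (tendsto_one_div_add_atTop_nhds_zero_nat (𝕜 := ℝ)).const_mul (dist x y / 2)
  have hpos : ∀ n, 0 < e n := fun n => by positivity
  have hle : ∀ n, 2 * e n ≤ dist x y := by
    intro n
    have : 1 / ((n : ℝ) + 1) ≤ 1 := by
      rw [div_le_one (by positivity)]; linarith [Nat.cast_nonneg (α := ℝ) n]
    simp only [e]
    nlinarith
  choose γ h1 h2 h3 h4 using fun n =>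
    hK.exists_almost_lipschitz_curve hfin hx hy (hpos n) (hle n)
  exact ⟨Real.toNNReal (6 * (μH[1] K).toReal), hc.exists_lipschitz_limit_curve h1
    (A := fun _ => 6 * (μH[1] K).toReal)
    (by rw [Real.coe_toNNReal _ (by positivity)]; exact tendsto_const_nhds)
    (by simpa using he.const_mul 2) h4 h2 h3⟩

/-- Two points of a compact connected set of finite length are joined by a Lipschitz arc. -/
theorem IsCompact.exists_lipschitz_arc {K : Set X} (hc : IsCompact K)
    (hK : IsPreconnected K) (hfin : μH[1] K < ∞) {x y : X} (hx : x ∈ K) (hy : y ∈ K)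
    (hxy : x ≠ y) :
    ∃ (L : ℝ≥0) (γ : ℝ → X), (∀ t, γ t ∈ K) ∧ LipschitzWith L γ ∧ γ 0 = x ∧ γ 1 = y ∧
      Set.InjOn γ (Set.Icc 0 1) := by
  -- Minimise the Lipschitz constant among curves from `x` to `y`. Compactness attains the infimum,
  -- and a minimiser is injective because a shortcut would lower its positive constant.
  let S : Set ℝ≥0 := {L | ∃ η : ℝ → X, (∀ t, η t ∈ K) ∧ LipschitzWith L η ∧ η 0 = x ∧ η 1 = y}
  have hS : S.Nonempty := hc.exists_lipschitz_curve hK hfin hx hy hxy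
  obtain ⟨A, -, hA, hAS⟩ := exists_seq_tendsto_sInf hS (OrderBot.bddBelow S)
  choose η h1 h2 h3 h4 using hAS
  obtain ⟨γ, g1, g2, g3, g4⟩ := hc.exists_lipschitz_limit_curve (x := x) (y := y) h1
    (A := fun n => A n) (e := fun _ => 0) (L := sInf S)
    (NNReal.tendsto_coe.2 hA) tendsto_const_nhds
    (fun n s t => by simpa [Real.dist_eq] using (h2 n).dist_le_mul s t) (by simp [h3]) (by simp [h4])
  refine ⟨sInf S, γ, g1, g2, g3, g4, ?_⟩
  have hpos : 0 < sInf S := by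
    rw [pos_iff_ne_zero]
    intro h0
    rw [h0] at g2
    have := g2.dist_le_mul 0 1
    rw [g3, g4] at this
    simp only [NNReal.coe_zero, zero_mul, dist_le_zero] at this
    exact hxy this
  have key : ∀ s t, 0 ≤ s → s < t → t ≤ 1 → γ s ≠ γ t := by
    intro s t hs hst ht h
    obtain ⟨ζ, z1, z2, z3, z4⟩ := g2.exists_shortcut hs hst.le ht h (by rw [g3, g4]; exact hxy)
    have hmem : sInf S * Real.toNNReal (1 - (t - s)) ∈ S := by
      refine ⟨ζ, fun r => ?_, z4, z2.trans g3, z3.trans g4⟩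
      obtain ⟨q, hq⟩ := z1 ⟨r, rfl⟩
      exact hq ▸ g1 q
    have hle : sInf S ≤ sInf S * Real.toNNReal (1 - (t - s)) := csInf_le (OrderBot.bddBelow S) hmem
    have hlt : Real.toNNReal (1 - (t - s)) < 1 := by
      rw [Real.toNNReal_lt_one]; linarith
    exact absurd hle (not_le.2 (mul_lt_of_lt_one_right hpos hlt))
  intro s hs t ht h
  rcases lt_trichotomy s t with hlt | heq | hlt
  · exact absurd h (key s t hs.1 hlt ht.2)
  · exact heq
  · exact absurd h.symm (key t s ht.1 hlt hs.2)

end Curves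

/-! ### Speed along an arc against the length of its image -/

section ArcLength

open Set
open scoped NNReal

theorem Continuous.measurableEmbedding_Icc {X : Type*} [TopologicalSpace X] [T2Space X]
    [MeasurableSpace X] [BorelSpace X] {γ : ℝ → X} (hγ : Continuous γ) (hinj : InjOn γ (Icc 0 1)) :
    MeasurableEmbedding fun t : Icc (0 : ℝ) 1 => γ t :=
  ((hγ.comp continuous_subtype_val).isClosedEmbedding
    (injOn_iff_injective.1 hinj)).measurableEmbedding

/-- The slope is symmetric to match the centred balls `[t - r, t + r]` in the differentiation of
measures. -/
theorem HasDerivAt.tendsto_symmetric_slope {E : Type*} [NormedAddCommGroup E]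
    [NormedSpace ℝ E] {γ : ℝ → E} {γ' : E} {t : ℝ} (h : HasDerivAt γ γ' t) :
    Tendsto (fun r : ℝ => edist (γ (t - r)) (γ (t + r)) / ENNReal.ofReal (2 * r)) (𝓝[>] 0)
      (𝓝 ‖γ'‖ₑ) := by
  have h1 : HasDerivAt (fun r : ℝ => γ (t + r) - γ (t - r)) (γ' + γ') 0 := by
    have ha : HasDerivAt (fun r : ℝ => γ (t + r)) γ' 0 := by
      have h0 : HasDerivAt γ γ' (t + 0) := by simpa using h
      simpa using h0.comp_const_add t 0
    have hb : HasDerivAt (fun r : ℝ => γ (t - r)) (-γ') 0 := by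
      have h0 : HasDerivAt γ γ' (t - 0) := by simpa using h
      simpa using h0.comp_const_sub t 0
    simpa using ha.fun_sub hb
  have h2 := (h1.tendsto_slope_zero_right.const_smul (1 / 2 : ℝ)).enorm
  have h3 : (1 / 2 : ℝ) • (γ' + γ') = γ' := by rw [← two_smul ℝ γ', smul_smul]; norm_num
  rw [h3] at h2
  refine h2.congr' ?_
  filter_upwards [self_mem_nhdsWithin] with r hr
  have hr : 0 < r := hr
  simp only [zero_add, add_zero, sub_zero, sub_self]
  rw [smul_smul, enorm_smul, edist_comm, edist_eq_enorm_sub, ENNReal.div_eq_inv_mul,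
    ← ENNReal.ofReal_inv_of_pos (by positivity), Real.enorm_of_nonneg (by positivity)]
  congr 2
  field_simp

variable {E : Type*} [NormedAddCommGroup E] [MeasurableSpace E] [BorelSpace E]

/-- The measure `T ↦ μH[1] (γ '' (T ∩ [0, 1]))`, for injective `γ`. -/
noncomputable def imageMeasure (γ : ℝ → E) : Measure ℝ :=
  (Measure.comap (fun t : Icc (0 : ℝ) 1 => γ t) μH[1]).map Subtype.val

variable {γ : ℝ → E}

theorem edist_le_imageMeasure (hγ : Continuous γ) (hinj : InjOn γ (Icc 0 1)) {a b : ℝ}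
    (ha : 0 ≤ a) (hab : a ≤ b) (hb : b ≤ 1) :
    edist (γ a) (γ b) ≤ imageMeasure γ (Icc a b) := by
  have himg : (fun t : Icc (0 : ℝ) 1 => γ t) '' (Subtype.val ⁻¹' Icc a b) = γ '' Icc a b := by
    rw [show (fun t : Icc (0 : ℝ) 1 => γ t) = γ ∘ Subtype.val from rfl, image_comp,
      Subtype.image_preimage_coe, inter_eq_right.2 (Icc_subset_Icc ha hb)]
  rw [imageMeasure, Measure.map_apply measurable_subtype_coe measurableSet_Icc,
    (Continuous.measurableEmbedding_Icc hγ hinj).comap_apply, himg]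
  exact (isPreconnected_Icc.image γ hγ.continuousOn).edist_le_hausdorffMeasure
    (mem_image_of_mem _ (left_mem_Icc.2 hab)) (mem_image_of_mem _ (right_mem_Icc.2 hab))

theorem map_imageMeasure (hγ : Continuous γ) (hinj : InjOn γ (Icc 0 1)) :
    (imageMeasure γ).map γ = (μH[1]).restrict (γ '' Icc 0 1) := by
  rw [imageMeasure, Measure.map_map hγ.measurable measurable_subtype_coe]
  change Measure.map (fun t : Icc (0 : ℝ) 1 => γ t) _ = _
  rw [(Continuous.measurableEmbedding_Icc hγ hinj).map_comap, image_eq_range]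

/-- No measurability of `f` is needed, because `γ` on `[0, 1]` is a measurable embedding. -/
theorem eLpNorm_comp_imageMeasure {F : Type*} [NormedAddCommGroup F] (hγ : Continuous γ)
    (hinj : InjOn γ (Icc 0 1)) (f : E → F) (p : ℝ≥0∞) :
    eLpNorm (f ∘ γ) p (imageMeasure γ) = eLpNorm f p ((μH[1]).restrict (γ '' Icc 0 1)) := by
  have hemb := Continuous.measurableEmbedding_Icc hγ hinj
  rw [imageMeasure, (MeasurableEmbedding.subtype_coe measurableSet_Icc).eLpNorm_map_measure,
    image_eq_range, ← hemb.map_comap, hemb.eLpNorm_map_measure]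
  rfl

theorem isFiniteMeasure_imageMeasure (hγ : Continuous γ) (hinj : InjOn γ (Icc 0 1))
    (hfin : μH[1] (γ '' Icc 0 1) < ∞) : IsFiniteMeasure (imageMeasure γ) := by
  refine ⟨?_⟩
  have := congrArg (fun μ => μ univ) (map_imageMeasure hγ hinj)
  simp only [Measure.map_apply hγ.measurable MeasurableSet.univ, preimage_univ,
    Measure.restrict_apply_univ] at this
  rwa [this]

/-- The measure `‖γ'(t)‖ dt` on `(0, 1)`. -/
noncomputable def speedMeasure {E : Type*} [NormedAddCommGroup E] [NormedSpace ℝ E]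
    (γ : ℝ → E) : Measure ℝ :=
  (volume.restrict (Ioo 0 1)).withDensity fun t => ‖deriv γ t‖ₑ

/-- The chord over `[t - r, t + r]` is no longer than the arc above it. Dividing by `2 r` and
letting `r → 0` bounds the speed by the density of `imageMeasure γ`. -/
theorem speedMeasure_le_imageMeasure [NormedSpace ℝ E] [FiniteDimensional ℝ E] {L : ℝ≥0} (hγ : LipschitzWith L γ)
    (hinj : InjOn γ (Icc 0 1)) (hfin : μH[1] (γ '' Icc 0 1) < ∞) :
    speedMeasure γ ≤ imageMeasure γ := by
  have := isFiniteMeasure_imageMeasure hγ.continuous hinj hfin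
  have hle : ∀ᵐ t ∂(volume.restrict (Ioo (0 : ℝ) 1)),
      ‖deriv γ t‖ₑ ≤ (imageMeasure γ).rnDeriv volume t := by
    filter_upwards [ae_restrict_mem measurableSet_Ioo,
      ae_restrict_of_ae hγ.ae_differentiableAt_real,
      ae_restrict_of_ae (Besicovitch.ae_tendsto_rnDeriv (imageMeasure γ) volume)] with t ht hd hlim
    refine le_of_tendsto_of_tendsto hd.hasDerivAt.tendsto_symmetric_slope hlim ?_
    have hsmall : ∀ᶠ r in 𝓝[>] (0 : ℝ), r < min t (1 - t) :=
      mem_nhdsWithin_of_mem_nhds (Iio_mem_nhds (lt_min ht.1 (by linarith [ht.2])))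
    filter_upwards [self_mem_nhdsWithin, hsmall] with r hr hr'
    have hr : 0 < r := hr
    obtain ⟨h1, h2⟩ := lt_min_iff.1 hr'
    rw [Real.closedBall_eq_Icc, Real.volume_Icc, show t + r - (t - r) = 2 * r by ring]
    gcongr
    exact edist_le_imageMeasure hγ.continuous hinj (by linarith) (by linarith) (by linarith)
  calc speedMeasure γ ≤ (volume.restrict (Ioo 0 1)).withDensity ((imageMeasure γ).rnDeriv volume) :=
        withDensity_mono hle
    _ ≤ volume.withDensity ((imageMeasure γ).rnDeriv volume) := by
        rw [← restrict_withDensity measurableSet_Ioo]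
        exact Measure.restrict_le_self
    _ ≤ _ := Measure.withDensity_rnDeriv_le _ _

end ArcLength

/-! ### Approximate tangent lines along an arc -/

section Tangent

open Set
open scoped NNReal

/-- Closeness in space forces closeness in time: by injectivity, `γ t` lies off the compact image of
the times away from `t`. -/
theorem Continuous.eventually_mem_of_mem_closedBall {X : Type*} [MetricSpace X] {γ : ℝ → X}
    (hγ : Continuous γ) (hinj : InjOn γ (Icc 0 1)) {t : ℝ} (ht : t ∈ Icc (0 : ℝ) 1)
    {p : ℝ → Prop} (hp : ∀ᶠ s in 𝓝 t, p s) :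
    ∀ᶠ r in 𝓝[>] (0 : ℝ), ∀ s ∈ Icc (0 : ℝ) 1, γ s ∈ Metric.closedBall (γ t) r → p s := by
  obtain ⟨U, hU, hUo, htU⟩ := eventually_nhds_iff.1 hp
  have hclosed : IsClosed (γ '' (Icc 0 1 \ U)) :=
    ((isCompact_Icc.diff hUo).image hγ).isClosed
  have hnot : γ t ∈ (γ '' (Icc 0 1 \ U))ᶜ := by
    rintro ⟨s, hs, hst⟩
    exact hs.2 (hinj hs.1 ht hst ▸ htU)
  obtain ⟨δ, hδ, hball⟩ := Metric.isOpen_iff.1 hclosed.isOpen_compl _ hnot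
  filter_upwards [mem_nhdsWithin_of_mem_nhds (Iio_mem_nhds hδ)] with r hr s hs hsr
  by_contra hns
  exact hball (Metric.closedBall_subset_ball hr hsr) ⟨s, ⟨hs, fun h => hns (hU s h)⟩, rfl⟩

theorem HasDerivAt.eventually_norm_sub_le {E : Type*} [NormedAddCommGroup E] [NormedSpace ℝ E]
    {γ : ℝ → E} {t : ℝ} {v : E} (h : HasDerivAt γ v t) {η : ℝ} (hη : 0 < η) :
    ∀ᶠ s in 𝓝 t, ‖γ s - γ t - (s - t) • v‖ ≤ η * |s - t| :=
  (hasDerivAt_iff_isLittleO.1 h).def hη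

theorem norm_sub_mul_abs_le {E : Type*} [NormedAddCommGroup E] [NormedSpace ℝ E]
    {z v : E} {a η : ℝ} (h : ‖z - a • v‖ ≤ η * |a|) : (‖v‖ - η) * |a| ≤ ‖z‖ := by
  have h1 := norm_sub_norm_le (a • v) z
  rw [norm_sub_rev, norm_smul, Real.norm_eq_abs] at h1
  linarith

/-- The time that an arc spends in a small ball around one of its regular points. -/
theorem HasDerivAt.eventually_measure_preimage_closedBall_le {E : Type*} [NormedAddCommGroup E]
    [NormedSpace ℝ E] [MeasurableSpace E] [BorelSpace E] {γ : ℝ → E} (hγ : Continuous γ)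
    (hinj : InjOn γ (Icc 0 1)) {t : ℝ} (ht : t ∈ Icc (0 : ℝ) 1) {v : E} (h : HasDerivAt γ v t)
    (hv : v ≠ 0) :
    ∀ᶠ r in 𝓝[>] (0 : ℝ), (volume.restrict (Ioo 0 1)).map γ (Metric.closedBall (γ t) r) ≤
      ENNReal.ofReal (4 / ‖v‖) * ENNReal.ofReal r := by
  have hv' : 0 < ‖v‖ := norm_pos_iff.2 hv
  filter_upwards [self_mem_nhdsWithin, hγ.eventually_mem_of_mem_closedBall hinj ht
    (h.eventually_norm_sub_le (half_pos hv'))] with r hr hball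
  have hr : 0 < r := hr
  rw [Measure.map_apply hγ.measurable Metric.isClosed_closedBall.measurableSet,
    Measure.restrict_apply (hγ.measurable Metric.isClosed_closedBall.measurableSet)]
  have hsub : γ ⁻¹' Metric.closedBall (γ t) r ∩ Ioo 0 1 ⊆ Metric.closedBall t (2 / ‖v‖ * r) := by
    rintro s ⟨hs, hs'⟩
    have h1 := norm_sub_mul_abs_le (hball s (Ioo_subset_Icc_self hs') hs)
    have h2 : ‖γ s - γ t‖ ≤ r := by rw [← dist_eq_norm]; exact hs
    rw [Metric.mem_closedBall, Real.dist_eq, div_mul_eq_mul_div, le_div_iff₀ hv']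
    nlinarith
  refine (measure_mono hsub).trans ?_
  rw [Real.volume_closedBall, ← ENNReal.ofReal_mul (by positivity)]
  exact ENNReal.ofReal_le_ofReal (by ring_nf; rfl)

theorem HasDerivAt.eventually_mem_coneAround {γ : ℝ → Plane} (hγ : Continuous γ)
    (hinj : InjOn γ (Icc 0 1)) {t : ℝ} (ht : t ∈ Icc (0 : ℝ) 1) {v : Plane} (h : HasDerivAt γ v t)
    (hv : v ≠ 0) {s₀ : ℝ} (h0 : 0 < s₀) (h1 : s₀ < 1) :
    ∀ᶠ r in 𝓝[>] (0 : ℝ), ∀ s ∈ Icc (0 : ℝ) 1, γ s ∈ Metric.closedBall (γ t) r → s ≠ t →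
      γ s ∈ coneAround (γ t) (Submodule.span ℝ {v}) s₀ := by
  have hv' : 0 < ‖v‖ := norm_pos_iff.2 hv
  -- With error `s₀ ‖v‖ / 4` per unit time, the chord is longer than `3/4 ‖v‖ |s - t|`, which leaves
  -- room for the strict cone inequality.
  filter_upwards [hγ.eventually_mem_of_mem_closedBall hinj ht
    (h.eventually_norm_sub_le (show 0 < s₀ * ‖v‖ / 4 by positivity))] with r hball s hs hsr hne
  have ha := hball s hs hsr
  have hb := norm_sub_mul_abs_le ha
  have hpos : 0 < |s - t| := abs_pos.2 (sub_ne_zero.2 hne)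
  change Metric.infDist (γ s - γ t) _ < s₀ * ‖γ s - γ t‖
  calc Metric.infDist (γ s - γ t) (Submodule.span ℝ {v} : Submodule ℝ Plane)
      ≤ dist (γ s - γ t) ((s - t) • v) :=
        Metric.infDist_le_dist_of_mem (Submodule.smul_mem _ _ (Submodule.mem_span_singleton_self v))
    _ ≤ s₀ * ‖v‖ / 4 * |s - t| := by rw [dist_eq_norm]; exact ha
    _ < s₀ * ((‖v‖ - s₀ * ‖v‖ / 4) * |s - t|) := by
        have : 0 < s₀ * ‖v‖ * |s - t| := by positivity
        nlinarith
    _ ≤ _ := by gcongr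

/-- Length on `K` off the arc is singular to the image `ν` of `dt`, so its ratio to `ν` on small
balls tends to zero `ν`-almost everywhere. Where the derivative is nonzero, `ν` of a ball is `O(r)`.
-/
theorem ae_tendsto_density_diff_arc {E : Type*} [NormedAddCommGroup E] [NormedSpace ℝ E]
    [FiniteDimensional ℝ E] [MeasurableSpace E] [BorelSpace E] {K : Set E} (hfin : μH[1] K < ∞)
    {γ : ℝ → E} (hγ : Continuous γ) (hinj : InjOn γ (Icc 0 1)) :
    ∀ᵐ t ∂(volume.restrict (Ioo (0 : ℝ) 1)), ∀ v : E, v ≠ 0 → HasDerivAt γ v t →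
      Tendsto (fun r : ℝ => μH[1] ((K \ γ '' Icc 0 1) ∩ Metric.closedBall (γ t) r) /
        ENNReal.ofReal r) (𝓝[>] 0) (𝓝 0) := by
  set ρ : Measure E := (μH[1]).restrict (K \ γ '' Icc 0 1) with hρ
  set ν : Measure E := (volume.restrict (Ioo (0 : ℝ) 1)).map γ with hν
  have hmeas : MeasurableSet (γ '' Icc 0 1) := (isCompact_Icc.image hγ).isClosed.measurableSet
  have : IsFiniteMeasure ρ :=
    ⟨by rw [hρ, Measure.restrict_apply_univ]; exact (measure_mono sdiff_subset).trans_lt hfin⟩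
  have hsing : ρ ⟂ₘ ν := by
    refine ⟨γ '' Icc 0 1, hmeas, ?_, ?_⟩
    · rw [hρ, Measure.restrict_apply hmeas]
      simp
    · rw [hν, Measure.map_apply hγ.measurable hmeas.compl,
        Measure.restrict_apply (hγ.measurable hmeas.compl)]
      convert measure_empty (μ := (volume : Measure ℝ))
      ext s
      simp only [mem_inter_iff, mem_preimage, mem_compl_iff, mem_empty_iff_false, iff_false]
      exact fun h => h.1 ⟨s, Ioo_subset_Icc_self h.2, rfl⟩
  have hlim : ∀ᵐ x ∂ν, Tendsto (fun r => ρ (Metric.closedBall x r) / ν (Metric.closedBall x r))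
      (𝓝[>] 0) (𝓝 0) := by
    filter_upwards [Besicovitch.ae_tendsto_rnDeriv ρ ν, (Measure.rnDeriv_eq_zero ρ ν).2 hsing]
      with x hx hx0
    rwa [hx0] at hx
  filter_upwards [ae_of_ae_map hγ.aemeasurable hlim, ae_restrict_mem measurableSet_Ioo]
    with t ht hmem v hv hd
  have hlim2 := ENNReal.Tendsto.mul_const (b := ENNReal.ofReal (4 / ‖v‖)) ht
    (Or.inr ENNReal.ofReal_ne_top)
  rw [zero_mul] at hlim2
  refine tendsto_of_tendsto_of_tendsto_of_le_of_le' tendsto_const_nhds hlim2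
    (Eventually.of_forall fun _ => zero_le) ?_
  filter_upwards [self_mem_nhdsWithin, ht.eventually (gt_mem_nhds zero_lt_one),
    hd.eventually_measure_preimage_closedBall_le hγ hinj (Ioo_subset_Icc_self hmem) hv]
    with r hr hlt hνr
  have hr' : ENNReal.ofReal r ≠ 0 := (ENNReal.ofReal_pos.2 hr).ne'
  have hρr : μH[1] ((K \ γ '' Icc 0 1) ∩ Metric.closedBall (γ t) r) =
      ρ (Metric.closedBall (γ t) r) := by
    rw [hρ, Measure.restrict_apply Metric.isClosed_closedBall.measurableSet, inter_comm]
  rw [hρr, ENNReal.div_le_iff hr' ENNReal.ofReal_ne_top, mul_assoc]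
  -- If `ν` vanishes on the ball, the ratio is `0` or `∞`; being below `1` it is `0`, so `ρ`
  -- vanishes too.
  rcases eq_or_ne (ν (Metric.closedBall (γ t) r)) 0 with h0 | h0
  · rw [h0] at hlt
    rcases eq_or_ne (ρ (Metric.closedBall (γ t) r)) 0 with h1 | h1
    · simp [h1]
    · rw [ENNReal.div_zero h1] at hlt
      simp at hlt
  · calc ρ (Metric.closedBall (γ t) r)
        = ρ (Metric.closedBall (γ t) r) / ν (Metric.closedBall (γ t) r) *
            ν (Metric.closedBall (γ t) r) := (ENNReal.div_mul_cancel h0 (measure_ne_top _ _)).symm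
      _ ≤ _ := by gcongr

theorem ae_isApproxTangentLine_of_arc {K : Set Plane} (hfin : μH[1] K < ∞)
    (hdens : ∀ x ∈ K, ∀ᶠ r in 𝓝[>] (0 : ℝ),
      ENNReal.ofReal r ≤ μH[1] (K ∩ Metric.closedBall x r))
    {γ : ℝ → Plane} (hγK : ∀ t, γ t ∈ K) (hγ : Continuous γ) (hinj : InjOn γ (Icc 0 1)) :
    ∀ᵐ t ∂(volume.restrict (Ioo (0 : ℝ) 1)), ∀ v : Plane, v ≠ 0 → HasDerivAt γ v t →
      IsApproxTangentLine K (γ t) (Submodule.span ℝ {v}) := by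
  filter_upwards [ae_tendsto_density_diff_arc hfin hγ hinj, ae_restrict_mem measurableSet_Ioo]
    with t ht hmem v hv hd
  refine ⟨finrank_span_singleton hv, ?_, fun s h0 h1 => ?_⟩
  · refine lt_of_lt_of_le (show (0 : ℝ≥0∞) < 1 / 2 by simp) (le_limsup_of_frequently_le ?_)
    refine Eventually.frequently ?_
    filter_upwards [self_mem_nhdsWithin, hdens _ (hγK t)] with r hr hle
    have hr : 0 < r := hr
    calc (1 / 2 : ℝ≥0∞) = ENNReal.ofReal r / ENNReal.ofReal (2 * r) := by
          rw [← ENNReal.ofReal_div_of_pos (by positivity), div_mul_cancel_right₀ hr.ne',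
            ENNReal.ofReal_inv_of_pos two_pos]
          simp
      _ ≤ _ := by gcongr
  · refine tendsto_of_tendsto_of_tendsto_of_le_of_le' tendsto_const_nhds (ht v hv hd)
      (Eventually.of_forall fun _ => zero_le) ?_
    filter_upwards [hd.eventually_mem_coneAround hγ hinj (Ioo_subset_Icc_self hmem) hv h0 h1]
      with r hcone
    refine ENNReal.div_le_div_right ?_ _
    -- The vertex lies outside the open cone, but a single point has no length.
    have : NullSingletonClass (μH[1] : Measure Plane) :=
      Measure.nullSingletonClass_hausdorff Plane one_pos
    have hsub : (K ∩ Metric.closedBall (γ t) r) \ coneAround (γ t) (Submodule.span ℝ {v}) s ⊆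
        ((K \ γ '' Icc 0 1) ∩ Metric.closedBall (γ t) r) ∪ {γ t} := by
      rintro y ⟨⟨hyK, hyB⟩, hyC⟩
      by_cases hy : y ∈ γ '' Icc 0 1
      · obtain ⟨q, hq, rfl⟩ := hy
        right
        by_contra hne
        exact hyC (hcone q hq hyB fun h => hne (h ▸ rfl))
      · exact Or.inl ⟨⟨hyK, hy⟩, hyB⟩
    calc _ ≤ _ := measure_mono hsub
      _ ≤ _ := measure_union_le _ _
      _ = _ := by simp

theorem disjoint_coneAround {x τ v : Plane} (hτ : ‖τ‖ = 1) (h : τ ∉ Submodule.span ℝ {v}) :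
    ∃ s : ℝ, 0 < s ∧ s < 1 ∧ Disjoint (coneAround x (Submodule.span ℝ {τ}) s)
      (coneAround x (Submodule.span ℝ {v}) s) := by
  set V : Submodule ℝ Plane := Submodule.span ℝ {v} with hV
  set d := Metric.infDist τ (V : Set Plane) with hd
  have hVne : (V : Set Plane).Nonempty := ⟨0, V.zero_mem⟩
  have hdpos : 0 < d :=
    ((Submodule.closed_of_finiteDimensional V).notMem_iff_infDist_pos hVne).1 h
  have hd1 : d ≤ 1 := by
    have := Metric.infDist_le_dist_of_mem (x := τ) V.zero_mem
    rwa [dist_zero_right, hτ] at this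
  -- A vector `z` in both cones is within `d/4 ‖z‖` of some `a • τ` and of `V`. Then `|a| ≥ 3/4
  -- ‖z‖`, so `a • τ` is at distance at least `3/4 d ‖z‖` from `V`, yet less than `d/2 ‖z‖`.
  refine ⟨d / 4, by positivity, by linarith, disjoint_left.2 fun y hy1 hy2 => ?_⟩
  set z := y - x with hz
  have hy1 : Metric.infDist z (Submodule.span ℝ {τ} : Submodule ℝ Plane) < d / 4 * ‖z‖ := hy1
  have hy2 : Metric.infDist z (V : Set Plane) < d / 4 * ‖z‖ := hy2
  obtain ⟨p, hp, hp'⟩ := (Metric.infDist_lt_iff ⟨0, Submodule.zero_mem _⟩).1 hy1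
  obtain ⟨q, hq, hq'⟩ := (Metric.infDist_lt_iff hVne).1 hy2
  obtain ⟨a, rfl⟩ := Submodule.mem_span_singleton.1 hp
  have ha : ‖z‖ - d / 4 * ‖z‖ ≤ |a| := by
    have := norm_sub_norm_le z (a • τ)
    rw [norm_smul, hτ, mul_one, Real.norm_eq_abs] at this
    rw [dist_eq_norm] at hp'
    linarith
  have hz0 : 0 < ‖z‖ := by
    have := dist_nonneg.trans_lt hq'
    exact pos_of_mul_pos_right this (by positivity)
  have hapos : 0 < |a| := by nlinarith
  have hdist : |a| * d ≤ dist (a • τ) q := by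
    have h1 : d ≤ dist τ (a⁻¹ • q) := Metric.infDist_le_dist_of_mem (V.smul_mem _ hq)
    have h2 : a • τ - q = a • (τ - a⁻¹ • q) := by
      rw [smul_sub, smul_inv_smul₀ (abs_pos.1 hapos)]
    rw [dist_eq_norm, h2, norm_smul, ← dist_eq_norm, Real.norm_eq_abs]
    gcongr
  have htri := dist_triangle_left (a • τ) q z
  have h34 : 3 / 4 * ‖z‖ * d ≤ |a| * d := by
    gcongr
    nlinarith
  nlinarith

/-- Approximate tangent lines are unique at points of positive lower density. -/
theorem IsApproxTangentLine.mem_span {K : Set Plane} {x τ v : Plane}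
    (hdens : ∀ᶠ r in 𝓝[>] (0 : ℝ), ENNReal.ofReal r ≤ μH[1] (K ∩ Metric.closedBall x r))
    (hτ : ‖τ‖ = 1) (h1 : IsApproxTangentLine K x (Submodule.span ℝ {τ}))
    (h2 : IsApproxTangentLine K x (Submodule.span ℝ {v})) : τ ∈ Submodule.span ℝ {v} := by
  by_contra hnot
  obtain ⟨s, hs0, hs1, hdisj⟩ := disjoint_coneAround (x := x) hτ hnot
  have hsum := (h1.2.2 s hs0 hs1).add (h2.2.2 s hs0 hs1)
  rw [add_zero] at hsum
  refine absurd (ge_of_tendsto (b := (1 : ℝ≥0∞)) hsum ?_) (by simp)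
  filter_upwards [self_mem_nhdsWithin, hdens] with r hr hle
  have hr' : ENNReal.ofReal r ≠ 0 := (ENNReal.ofReal_pos.2 hr).ne'
  rw [← ENNReal.add_div, ENNReal.le_div_iff_mul_le (Or.inl hr') (Or.inl ENNReal.ofReal_ne_top),
    one_mul]
  refine hle.trans ((measure_mono fun y hy => ?_).trans (measure_union_le _ _))
  by_cases hy1 : y ∈ coneAround x (Submodule.span ℝ {τ}) s
  · exact Or.inr ⟨hy, disjoint_left.1 hdisj hy1⟩
  · exact Or.inl ⟨hy, hy1⟩

/-- Uniqueness of the tangent line replaces the chosen `unitTangent` by an explicit expression in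
`v`, which is measurable along an arc. -/
theorem smoothTangentialGradient_eq {K : Set Plane} {x v : Plane} (φ : Plane → ℝ)
    (hdens : ∀ᶠ r in 𝓝[>] (0 : ℝ), ENNReal.ofReal r ≤ μH[1] (K ∩ Metric.closedBall x r))
    (hv : v ≠ 0) (h : IsApproxTangentLine K x (Submodule.span ℝ {v})) :
    smoothTangentialGradient K φ x = (inner ℝ (∇ φ x) v / ‖v‖ ^ 2) • v := by
  have hv' : ‖v‖ ≠ 0 := norm_ne_zero_iff.2 hv
  have hex : ∃ τ : Plane, ‖τ‖ = 1 ∧ IsApproxTangentLine K x (Submodule.span ℝ {τ}) := by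
    refine ⟨‖v‖⁻¹ • v, by rw [norm_smul, norm_inv, norm_norm, inv_mul_cancel₀ hv'], ?_⟩
    rwa [Submodule.span_singleton_smul_eq (IsUnit.mk0 _ (inv_ne_zero hv'))]
  have hu : unitTangent K x = hex.choose := dif_pos hex
  obtain ⟨hn, ht⟩ := hex.choose_spec
  rw [← hu] at hn ht
  obtain ⟨c, hc⟩ := Submodule.mem_span_singleton.1 (ht.mem_span hdens hn h)
  rw [smoothTangentialGradient, ← hc, inner_smul_right, smul_smul]
  congr 1
  rw [← hc, norm_smul, Real.norm_eq_abs] at hn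
  have hc2 : c ^ 2 * ‖v‖ ^ 2 = 1 := by rw [← sq_abs c, ← mul_pow, hn, one_pow]
  rw [eq_div_iff (by positivity)]
  linear_combination (inner ℝ (∇ φ x) v) * hc2

end Tangent

/-! ### Oscillation bound, averaging and passage to the limit -/

section Oscillation

open Set
open scoped NNReal

theorem eLpNorm_comp_speedMeasure_le {E F : Type*} [NormedAddCommGroup E] [NormedSpace ℝ E]
    [FiniteDimensional ℝ E] [MeasurableSpace E] [BorelSpace E] [NormedAddCommGroup F] {K : Set E}
    (hfin : μH[1] K < ∞) {L : ℝ≥0} {γ : ℝ → E} (hγ : LipschitzWith L γ)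
    (hinj : InjOn γ (Icc 0 1)) (hγK : ∀ t, γ t ∈ K) (f : E → F) (p : ℝ≥0∞) :
    eLpNorm (f ∘ γ) p (speedMeasure γ) ≤ eLpNorm f p ((μH[1]).restrict K) := by
  have hsub : γ '' Icc 0 1 ⊆ K := by rintro _ ⟨t, -, rfl⟩; exact hγK t
  calc _ ≤ eLpNorm (f ∘ γ) p (imageMeasure γ) := eLpNorm_mono_measure _
        (speedMeasure_le_imageMeasure hγ hinj ((measure_mono hsub).trans_lt hfin))
    _ = _ := eLpNorm_comp_imageMeasure hγ.continuous hinj f p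
    _ ≤ _ := eLpNorm_mono_measure _ (Measure.restrict_mono_set _ hsub)

theorem map_speedMeasure_le {E : Type*} [NormedAddCommGroup E] [NormedSpace ℝ E]
    [FiniteDimensional ℝ E] [MeasurableSpace E] [BorelSpace E] {K : Set E}
    (hfin : μH[1] K < ∞) {L : ℝ≥0} {γ : ℝ → E} (hγ : LipschitzWith L γ)
    (hinj : InjOn γ (Icc 0 1)) (hγK : ∀ t, γ t ∈ K) :
    (speedMeasure γ).map γ ≤ (μH[1]).restrict K := by
  have hsub : γ '' Icc 0 1 ⊆ K := by rintro _ ⟨t, -, rfl⟩; exact hγK t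
  calc _ ≤ (imageMeasure γ).map γ := Measure.map_mono
        (speedMeasure_le_imageMeasure hγ hinj ((measure_mono hsub).trans_lt hfin))
        hγ.continuous.measurable
    _ = _ := map_imageMeasure hγ.continuous hinj
    _ ≤ _ := Measure.restrict_mono_set _ hsub

theorem hasDerivAt_comp_gradient {E : Type*} [NormedAddCommGroup E] [InnerProductSpace ℝ E]
    [CompleteSpace E] {φ : E → ℝ} {γ : ℝ → E} {v : E} {t : ℝ} (hφ : DifferentiableAt ℝ φ (γ t))
    (hγ : HasDerivAt γ v t) : HasDerivAt (φ ∘ γ) (inner ℝ (∇ φ (γ t)) v) t := by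
  simpa using hφ.hasGradientAt.hasFDerivAt.comp_hasDerivAt t hγ

/-- `φ ∘ γ` is Lipschitz on `[0, 1]`, hence absolutely continuous, and the fundamental theorem of
calculus applies. -/
theorem enorm_sub_le_lintegral_inner_gradient {E : Type*} [NormedAddCommGroup E]
    [InnerProductSpace ℝ E] [FiniteDimensional ℝ E] {φ : E → ℝ} (hφ : ContDiff ℝ 1 φ)
    {L : ℝ≥0} {γ : ℝ → E} (hγ : LipschitzWith L γ) :
    ‖φ (γ 1) - φ (γ 0)‖ₑ ≤
      ∫⁻ t in Ioo (0 : ℝ) 1, ‖(inner ℝ (∇ φ (γ t)) (deriv γ t) : ℝ)‖ₑ := by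
  have hloc : LocallyLipschitz (φ ∘ γ) := hφ.locallyLipschitz.comp hγ.locallyLipschitz
  obtain ⟨M, hM⟩ := LocallyLipschitzOn.exists_lipschitzOnWith_of_compact
    (isCompact_uIcc (a := (0 : ℝ)) (b := 1)) hloc.locallyLipschitzOn
  have hint := hM.absolutelyContinuousOnInterval.integral_deriv_eq_sub
  rw [intervalIntegral.integral_of_le zero_le_one, integral_Ioc_eq_integral_Ioo] at hint
  change _ = φ (γ 1) - φ (γ 0) at hint
  rw [← hint]
  refine (enorm_integral_le_lintegral_enorm _).trans (lintegral_mono_ae ?_)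
  filter_upwards [ae_restrict_of_ae hγ.ae_differentiableAt_real] with t ht
  rw [(hasDerivAt_comp_gradient (hφ.differentiable one_ne_zero _) ht.hasDerivAt).deriv]

theorem enorm_mul_enorm_inner_div_smul {E : Type*} [NormedAddCommGroup E] [InnerProductSpace ℝ E]
    (w v : E) : ‖v‖ₑ * ‖(inner ℝ w v / ‖v‖ ^ 2) • v‖ₑ = ‖(inner ℝ w v : ℝ)‖ₑ := by
  rcases eq_or_ne v 0 with rfl | hv
  · simp
  · have hv' : ‖v‖ ≠ 0 := norm_ne_zero_iff.2 hv
    rw [← enorm_norm v, ← enorm_norm ((inner ℝ w v / ‖v‖ ^ 2) • v), ← enorm_mul,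
      ← enorm_norm (inner ℝ w v : ℝ), norm_smul, norm_div, norm_pow, norm_norm]
    congr 1
    field_simp

theorem IsPreconnected.eventually_ofReal_le_hausdorffMeasure {X : Type*} [MetricSpace X]
    [MeasurableSpace X] [BorelSpace X] {K : Set X} (hK : IsPreconnected K) (hnt : K.Nontrivial)
    {x : X} (hx : x ∈ K) :
    ∀ᶠ r in 𝓝[>] (0 : ℝ), ENNReal.ofReal r ≤ μH[1] (K ∩ Metric.closedBall x r) := by
  obtain ⟨z, hz, hne⟩ := hnt.exists_ne x
  filter_upwards [mem_nhdsWithin_of_mem_nhds (Iio_mem_nhds (dist_pos.2 hne.symm))] with r hr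
  exact hK.ofReal_le_hausdorffMeasure_inter_closedBall hx hz (le_of_lt hr)

/-- `speedMeasure γ` ignores the times where `γ' = 0`, at which the arc gives no tangent. -/
theorem ae_smoothTangentialGradient_comp_eq {K : Set Plane} (hK : IsPreconnected K)
    (hnt : K.Nontrivial) (hfin : μH[1] K < ∞) {L : ℝ≥0} {γ : ℝ → Plane} (hγ : LipschitzWith L γ)
    (hinj : InjOn γ (Icc 0 1)) (hγK : ∀ t, γ t ∈ K) (φ : Plane → ℝ) :
    smoothTangentialGradient K φ ∘ γ =ᵐ[speedMeasure γ]
      fun t => (inner ℝ (∇ φ (γ t)) (deriv γ t) / ‖deriv γ t‖ ^ 2) • deriv γ t := by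
  have hdens := fun x (hx : x ∈ K) => hK.eventually_ofReal_le_hausdorffMeasure hnt hx
  rw [EventuallyEq, speedMeasure, ae_withDensity_iff (stronglyMeasurable_deriv γ).enorm]
  filter_upwards [ae_restrict_of_ae hγ.ae_differentiableAt_real,
    ae_isApproxTangentLine_of_arc hfin hdens hγK hγ.continuous hinj] with t hd ht hne
  have hv : deriv γ t ≠ 0 := enorm_ne_zero.1 hne
  exact smoothTangentialGradient_eq φ (hdens _ (hγK t)) hv (ht _ hv hd.hasDerivAt)

/-- The bound keeps `g` apart because the triangle inequality needs measurable functions and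
`unitTangent` is a pointwise choice. It is applied on the arc, where the tangential gradient agrees
almost everywhere with the measurable `P`. -/
theorem enorm_sub_le_of_mem {K : Set Plane} (hc : IsCompact K) (hK : IsPreconnected K)
    (hfin : μH[1] K < ∞) {φ : Plane → ℝ} (hφ : ContDiff ℝ 1 φ) {g : Plane → Plane}
    (hg : AEStronglyMeasurable g (lengthOn K)) {x y : Plane} (hx : x ∈ K) (hy : y ∈ K) :
    ‖φ x - φ y‖ₑ ≤ (μH[1] K) ^ (1 / 2 : ℝ) *
      (eLpNorm (fun z => smoothTangentialGradient K φ z - g z) 2 (lengthOn K) +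
        eLpNorm g 2 (lengthOn K)) := by
  rcases eq_or_ne y x with rfl | hxy
  · simp
  obtain ⟨L, γ, hγK, hγ, rfl, rfl, hinj⟩ := hc.exists_lipschitz_arc hK hfin hy hx hxy
  set G := smoothTangentialGradient K φ
  set P : ℝ → Plane :=
    fun t => (inner ℝ (∇ φ (γ t)) (deriv γ t) / ‖deriv γ t‖ ^ 2) • deriv γ t with hP
  have hGP : G ∘ γ =ᵐ[speedMeasure γ] P :=
    ae_smoothTangentialGradient_comp_eq hK ⟨_, hx, _, hy, hxy.symm⟩ hfin hγ hinj hγK φ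
  have hgrad : Continuous (∇ φ) :=
    (InnerProductSpace.toDual ℝ Plane).symm.continuous.comp (hφ.continuous_fderiv one_ne_zero)
  have hmd := stronglyMeasurable_deriv γ
  have hPm : StronglyMeasurable P := by
    have h1 : StronglyMeasurable fun t => ∇ φ (γ t) :=
      (hgrad.comp hγ.continuous).stronglyMeasurable
    have h2 : Measurable fun t => (inner ℝ (∇ φ (γ t)) (deriv γ t) : ℝ) / ‖deriv γ t‖ ^ 2 :=
      (h1.inner hmd).measurable.div (hmd.norm.measurable.pow_const 2)
    exact h2.stronglyMeasurable.smul hmd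
  have hgγ : AEStronglyMeasurable (g ∘ γ) (speedMeasure γ) :=
    (hg.mono_measure (map_speedMeasure_le hfin hγ hinj hγK)).comp_measurable
      hγ.continuous.measurable
  have hle := fun f : Plane → Plane => eLpNorm_comp_speedMeasure_le hfin hγ hinj hγK f 2
  have huniv : speedMeasure γ univ ≤ μH[1] K := by
    have := map_speedMeasure_le hfin hγ hinj hγK univ
    rwa [Measure.map_apply hγ.continuous.measurable MeasurableSet.univ, preimage_univ,
      Measure.restrict_apply_univ] at this
  calc ‖φ (γ 1) - φ (γ 0)‖ₑ
      ≤ ∫⁻ t in Ioo (0 : ℝ) 1, ‖(inner ℝ (∇ φ (γ t)) (deriv γ t) : ℝ)‖ₑ :=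
        enorm_sub_le_lintegral_inner_gradient hφ hγ
    _ = eLpNorm P 1 (speedMeasure γ) := by
        rw [eLpNorm_one_eq_lintegral_enorm, speedMeasure,
          lintegral_withDensity_eq_lintegral_mul _ hmd.enorm hPm.enorm]
        simp only [Pi.mul_apply, hP, enorm_mul_enorm_inner_div_smul]
    _ ≤ eLpNorm P 2 (speedMeasure γ) * speedMeasure γ univ ^ (1 / 2 : ℝ) := by
        refine (eLpNorm_le_eLpNorm_mul_rpow_measure_univ one_le_two
          hPm.aestronglyMeasurable).trans_eq ?_
        norm_num
    _ ≤ eLpNorm P 2 (speedMeasure γ) * (μH[1] K) ^ (1 / 2 : ℝ) := by gcongr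
    _ = (μH[1] K) ^ (1 / 2 : ℝ) * eLpNorm ((P - g ∘ γ) + g ∘ γ) 2 (speedMeasure γ) := by
        rw [sub_add_cancel, mul_comm]
    _ ≤ (μH[1] K) ^ (1 / 2 : ℝ) * (eLpNorm (P - g ∘ γ) 2 (speedMeasure γ) +
          eLpNorm (g ∘ γ) 2 (speedMeasure γ)) := by
        gcongr
        exact eLpNorm_add_le (hPm.aestronglyMeasurable.sub hgγ) hgγ one_le_two
    _ ≤ _ := by
        gcongr
        · have hae : P - g ∘ γ =ᵐ[speedMeasure γ] (fun z => G z - g z) ∘ γ :=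
            (hGP.symm.sub (EventuallyEq.refl _ (g ∘ γ)))
          rw [eLpNorm_congr_ae hae]
          exact hle _
        · exact hle _

/-- Integrate `|φ x| ≤ |φ y| + D` over `y` in `K`, apply Cauchy–Schwarz to `φ`, and divide by `μH[1]
K`. -/
theorem eLpNorm_top_le_of_contDiff {K : Set Plane} (hc : IsCompact K) (hK : IsPreconnected K)
    (hpos : μH[1] K ≠ 0) (hfin : μH[1] K < ∞) {φ : Plane → ℝ} (hφ : ContDiff ℝ 1 φ)
    {g : Plane → Plane} (hg : AEStronglyMeasurable g (lengthOn K)) :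
    eLpNorm φ ∞ (lengthOn K) ≤
      1 / (μH[1] K) ^ (1 / 2 : ℝ) * eLpNorm φ 2 (lengthOn K) + (μH[1] K) ^ (1 / 2 : ℝ) *
        (eLpNorm (fun z => smoothTangentialGradient K φ z - g z) 2 (lengthOn K) +
          eLpNorm g 2 (lengthOn K)) := by
  set D := (μH[1] K) ^ (1 / 2 : ℝ) *
    (eLpNorm (fun z => smoothTangentialGradient K φ z - g z) 2 (lengthOn K) +
      eLpNorm g 2 (lengthOn K)) with hD
  have hKm : MeasurableSet K := hc.isClosed.measurableSet
  have huniv : lengthOn K univ = μH[1] K := Measure.restrict_apply_univ _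
  rw [eLpNorm_exponent_top]
  refine eLpNormEssSup_le_of_ae_enorm_bound ?_
  filter_upwards [ae_restrict_mem hKm] with x hx
  have h1 : ‖φ x‖ₑ * μH[1] K ≤ eLpNorm φ 2 (lengthOn K) * (μH[1] K) ^ (1 / 2 : ℝ) +
      D * μH[1] K := by
    calc ‖φ x‖ₑ * μH[1] K = ∫⁻ _, ‖φ x‖ₑ ∂(lengthOn K) := by rw [lintegral_const, huniv]
      _ ≤ ∫⁻ y, (‖φ y‖ₑ + D) ∂(lengthOn K) := by
          refine lintegral_mono_ae ?_
          filter_upwards [ae_restrict_mem hKm] with y hy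
          calc ‖φ x‖ₑ = ‖φ y + (φ x - φ y)‖ₑ := by rw [add_sub_cancel]
            _ ≤ ‖φ y‖ₑ + ‖φ x - φ y‖ₑ := enorm_add_le _ _
            _ ≤ _ := by
              gcongr
              exact enorm_sub_le_of_mem hc hK hfin hφ hg hx hy
      _ = eLpNorm φ 1 (lengthOn K) + D * μH[1] K := by
          rw [lintegral_add_right _ measurable_const, lintegral_const, huniv,
            eLpNorm_one_eq_lintegral_enorm]
      _ ≤ _ := by
          gcongr
          refine (eLpNorm_le_eLpNorm_mul_rpow_measure_univ one_le_two
            hφ.continuous.aestronglyMeasurable).trans_eq ?_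
          rw [huniv]
          norm_num
  set H := μH[1] K
  have hs0 : H ^ (1 / 2 : ℝ) ≠ 0 := by simp [hpos, hfin.ne]
  have hst : H ^ (1 / 2 : ℝ) ≠ ∞ := by simp [hpos, hfin.ne]
  have hH : H ^ (1 / 2 : ℝ) * H ^ (1 / 2 : ℝ) = H := by
    rw [← ENNReal.rpow_add _ _ hpos hfin.ne]; norm_num
  have h2 : ‖φ x‖ₑ * H ≤ (1 / H ^ (1 / 2 : ℝ) * eLpNorm φ 2 (lengthOn K) + D) * H := by
    refine h1.trans_eq ?_
    rw [add_mul]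
    congr 1
    calc eLpNorm φ 2 (lengthOn K) * H ^ (1 / 2 : ℝ)
        = (H ^ (1 / 2 : ℝ))⁻¹ * H ^ (1 / 2 : ℝ) *
            (eLpNorm φ 2 (lengthOn K) * H ^ (1 / 2 : ℝ)) := by
          rw [ENNReal.inv_mul_cancel hs0 hst, one_mul]
      _ = 1 / H ^ (1 / 2 : ℝ) * eLpNorm φ 2 (lengthOn K) *
            (H ^ (1 / 2 : ℝ) * H ^ (1 / 2 : ℝ)) := by rw [one_div (H ^ _)]; ring
      _ = _ := by rw [hH]
  exact (ENNReal.mul_le_mul_iff_left hpos hfin.ne).1 h2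

/-- A subsequence of the smooth approximations converges almost everywhere, and the `L^∞` norm is
lower semicontinuous under such convergence. -/
theorem IsTangentialGradient.eLpNorm_top_le {K : Set Plane} (hc : IsCompact K)
    (hK : IsPreconnected K) (hpos : μH[1] K ≠ 0) (hfin : μH[1] K < ∞) {u : Plane → ℝ}
    {g : Plane → Plane} (hu : AEStronglyMeasurable u (lengthOn K))
    (h : IsTangentialGradient K u g) :
    eLpNorm u ∞ (lengthOn K) ≤
      1 / (μH[1] K) ^ (1 / 2 : ℝ) * eLpNorm u 2 (lengthOn K) +
        (μH[1] K) ^ (1 / 2 : ℝ) * eLpNorm g 2 (lengthOn K) := by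
  obtain ⟨hg, φ, hφ, hφu, hφg⟩ := h
  have hφm : ∀ n, AEStronglyMeasurable (φ n) (lengthOn K) :=
    fun n => (hφ n).continuous.aestronglyMeasurable
  set H := μH[1] K
  have hst : H ^ (1 / 2 : ℝ) ≠ ∞ := by simp [hpos, hfin.ne]
  have hsi : 1 / H ^ (1 / 2 : ℝ) ≠ ∞ := by simp [hpos, hfin.ne]
  obtain ⟨k, hk, hlim⟩ :=
    (tendstoInMeasure_of_tendsto_eLpNorm two_ne_zero hφm hu hφu).exists_seq_tendsto_ae
  let R : ℕ → ℝ≥0∞ := fun n => 1 / H ^ (1 / 2 : ℝ) *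
    (eLpNorm (fun x => φ n x - u x) 2 (lengthOn K) + eLpNorm u 2 (lengthOn K)) + H ^ (1 / 2 : ℝ) *
      (eLpNorm (fun z => smoothTangentialGradient K (φ n) z - g z) 2 (lengthOn K) +
        eLpNorm g 2 (lengthOn K))
  have hbound : ∀ n, eLpNorm (φ n) ∞ (lengthOn K) ≤ R n := by
    intro n
    refine (eLpNorm_top_le_of_contDiff hc hK hpos hfin ((hφ n).of_le (by exact_mod_cast le_top))
      hg.1).trans ?_
    simp only [R]
    gcongr
    calc eLpNorm (φ n) 2 (lengthOn K) = eLpNorm ((fun x => φ n x - u x) + u) 2 (lengthOn K) := by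
          congr 1; ext x; simp
      _ ≤ _ := eLpNorm_add_le ((hφm n).sub hu) hu one_le_two
  have hR : Tendsto R atTop (𝓝 (1 / H ^ (1 / 2 : ℝ) * (0 + eLpNorm u 2 (lengthOn K)) +
      H ^ (1 / 2 : ℝ) * (0 + eLpNorm g 2 (lengthOn K)))) :=
    (ENNReal.Tendsto.const_mul (hφu.add_const _) (Or.inr hsi)).add
      (ENNReal.Tendsto.const_mul (hφg.add_const _) (Or.inr hst))
  simp only [zero_add] at hR
  calc eLpNorm u ∞ (lengthOn K)
      ≤ liminf (fun n => eLpNorm (φ (k n)) ∞ (lengthOn K)) atTop :=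
        Lp.eLpNorm_lim_le_liminf_eLpNorm (fun n => hφm (k n)) u hlim
    _ ≤ liminf (fun n => R (k n)) atTop := liminf_le_liminf (Eventually.of_forall fun n => hbound _)
    _ = _ := (hR.comp hk.tendsto_atTop).liminf_eq

end Oscillation

theorem corollary2p4 (Ω : Set Plane) (hΩ : IsOpen Ω) (K : Set Plane) (hK : K ∈ roadClass Ω)
    (u : Plane → ℝ) (hu : u ∈ sobolevH1 K) :
    MemLp u ∞ (lengthOn K) ∧
    ∀ g : Plane → Plane, IsTangentialGradient K u g →
      eLpNorm u ∞ (lengthOn K) ≤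
        1 / (μH[1] K) ^ (1 / 2 : ℝ) * eLpNorm u 2 (lengthOn K) +
          (μH[1] K) ^ (1 / 2 : ℝ) * eLpNorm g 2 (lengthOn K) := by
  obtain ⟨-, hc, hconn, hfin⟩ := hK
  obtain ⟨hu2, g₀, hg₀⟩ := hu
  rcases eq_or_ne (μH[1] K) 0 with h0 | hpos
  -- Here every norm is zero, and the coefficient `1 / 0 = ∞` is harmless since `∞ * 0 = 0`.
  · have hzero : lengthOn K = 0 := Measure.restrict_eq_zero.2 h0
    simp [hzero]
  · have key := fun g (hg : IsTangentialGradient K u g) =>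
      hg.eLpNorm_top_le hc hconn.isPreconnected hpos hfin hu2.1
    refine ⟨⟨hu2.1, (key g₀ hg₀).trans_lt ?_⟩, key⟩
    have hst : (μH[1] K) ^ (1 / 2 : ℝ) < ∞ :=
      ENNReal.rpow_lt_top_of_nonneg (by norm_num) hfin.ne
    have hsi : 1 / (μH[1] K) ^ (1 / 2 : ℝ) < ∞ :=
      ENNReal.div_lt_top ENNReal.one_ne_top (ENNReal.rpow_pos (pos_iff_ne_zero.2 hpos) hfin.ne).ne'
    exact ENNReal.add_lt_top.2 ⟨ENNReal.mul_lt_top hsi hu2.2, ENNReal.mul_lt_top hst hg₀.1.2⟩
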